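/- Let $(M,\mu)$ be a finite-dimensional smooth Riemannian manifold and regard the metric as a bundle isomorphism $\mu: TM\to T^*M$. Let $\tau_{TM}: TM\to M$ and $\tau: T^*M\to M$ be the foot point projections. Let $\mathrm{Hor}(\mu)\subset TTM$ be the horizontal bundle of the Levi-Civita connection of $\mu$ (so that $TTM=\mathrm{Hor}(\mu)\oplus\ker T\tau_{TM}$), let $\mathrm{Hor}^*(\mu)=T\mu(\mathrm{Hor}(\mu))\subset TT^*M$, and let $\mathrm{Ver}=\ker T\tau\subset TT^*M$, so that $TT^*M=\mathrm{Hor}^*(\mu)\oplus\mathrm{Ver}$. Let $K^*: TT^*M\to T^*M$ be the connector of this induced connection: for $\alpha\in T_x^*M$ and $\xi\in T_\alpha T^*M$, $K^*(\xi)\in T_x^*M$ is the unique covector whose vertical lift $\frac{d}{dt}\big|_{t=0}(\alpha+tK^*(\xi))$ is the component of $\xi$ in $\mathrm{Ver}$ along $\mathrm{Hor}^*(\mu)$. Let $\theta$ be the Liouville form on $T^*M$, $\theta_\alpha(\xi)=\langle\alpha,T\tau(\xi)\rangle$, and let $\Omega=-d\theta$ be the canonical symplectic form, where $d\theta(X,Y)=X\theta(Y)-Y\theta(X)-\theta([X,Y])$.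 Then $$\Omega=\langle T\tau\overset{\wedge}{,}K^*\rangle,$$ that is, for all $\alpha\in T^*M$ and $\xi,\eta\in T_\alpha T^*M$, $$\Omega_\alpha(\xi,\eta)=\langle T\tau(\xi),K^*(\eta)\rangle-\langle T\tau(\eta),K^*(\xi)\rangle.$$ -/

import Mathlib

set_option linter.unusedSectionVars false
set_option linter.unusedSimpArgs false

open Bundle FiberBundle NormedSpace VectorField
open scoped Manifold ContDiff Topology

namespace RiemannianCotangent

noncomputable section

variable {E : Type*} [NormedAddCommGroup E] [NormedSpace ℝ E]
  {H : Type*} [TopologicalSpace H] {I : ModelWithCorners ℝ E H}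
  {M : Type*} [TopologicalSpace M] [ChartedSpace H M]

/-! ### Vertical spaces and vertical lifts -/

section Vertical

variable {F : Type*} [NormedAddCommGroup F] [NormedSpace ℝ F] {V : M → Type*}
  [TopologicalSpace (TotalSpace F V)] [∀ x, TopologicalSpace (V x)] [FiberBundle F V]

lemma mfderiv_totalSpace {E' : Type*} [NormedAddCommGroup E'] [NormedSpace ℝ E']
    {H' : Type*} [TopologicalSpace H'] {J : ModelWithCorners ℝ E' H'}
    {N : Type*} [TopologicalSpace N] [ChartedSpace H' N] {f : N → TotalSpace F V} {x : N}
    (hf : MDifferentiableAt J (I.prod 𝓘(ℝ, F)) f x) (u : TangentSpace J x) :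
    (mfderiv J (I.prod 𝓘(ℝ, F)) f x u : E × F) =
      (mfderiv J I (fun y => (f y).proj) x u,
        mfderiv J 𝓘(ℝ, F) (fun y => (trivializationAt F V (f x).proj (f y)).2) x u) := by
  obtain ⟨h1, h2⟩ := (mdifferentiableAt_totalSpace I f).1 hf
  have key : HasMFDerivAt J (I.prod 𝓘(ℝ, F)) f x
      ((mfderiv J I (fun y => (f y).proj) x : E' →L[ℝ] E).prod
        (mfderiv J 𝓘(ℝ, F) (fun y => (trivializationAt F V (f x).proj (f y)).2) x :
          E' →L[ℝ] F)) := by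
    refine ⟨hf.continuousAt, ?_⟩
    refine (h1.hasMFDerivAt.2.prodMk h2.hasMFDerivAt.2).congr_of_eventuallyEq ?_ ?_
    · have hc : ContinuousAt (fun z => f ((extChartAt J x).symm z)) (extChartAt J x x) :=
        ContinuousAt.comp (by simpa using hf.continuousAt) (continuousAt_extChartAt_symm x)
      have hb := ((continuous_proj F V).continuousAt.comp hc).preimage_mem_nhds
        ((trivializationAt F V (f x).proj).open_baseSet.mem_nhds
          (by simpa using mem_baseSet_trivializationAt F V (f x).proj))
      filter_upwards [mem_nhdsWithin_of_mem_nhds hb] with z hz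
      simp only [writtenInExtChartAt, FiberBundle.extChartAt, Function.comp_apply]
      refine Prod.ext ?_ rfl
      change (extChartAt I (f x).proj) ((trivializationAt F V (f x).proj)
        (f ((extChartAt J x).symm z))).1 = _
      rw [Trivialization.coe_fst' _ hz]
    · simp only [writtenInExtChartAt, FiberBundle.extChartAt, Function.comp_apply]
      refine Prod.ext ?_ rfl
      change (extChartAt I (f x).proj) ((trivializationAt F V (f x).proj)
        (f ((extChartAt J x).symm (extChartAt J x x)))).1 = _
      rw [Trivialization.coe_fst' _ (by simpa using mem_baseSet_trivializationAt F V (f x).proj)]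
  rw [key.mfderiv]
  rfl

/-- The derivative `T_p τ` of the foot point projection `τ` of a bundle. -/
def tangentProj (I : ModelWithCorners ℝ E H) (p : TotalSpace F V) :
    TangentSpace (I.prod 𝓘(ℝ, F)) p →L[ℝ] TangentSpace I p.proj :=
  mfderiv (I.prod 𝓘(ℝ, F)) I (TotalSpace.proj : TotalSpace F V → M) p

lemma tangentProj_apply (p : TotalSpace F V) (ξ : TangentSpace (I.prod 𝓘(ℝ, F)) p) :
    tangentProj I p ξ = Prod.fst (α := E) (β := F) ξ := by
  have h := mfderiv_totalSpace (I := I) (J := I.prod 𝓘(ℝ, F)) (V := V)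
    (mdifferentiableAt_id (x := p)) ξ
  rw [mfderiv_id] at h
  exact (congrArg Prod.fst h).symm

/-- The vertical space at `p`, i.e. the kernel of the derivative of the foot point projection. -/
def ver (I : ModelWithCorners ℝ E H) (p : TotalSpace F V) :
    Submodule ℝ (TangentSpace (I.prod 𝓘(ℝ, F)) p) :=
  LinearMap.ker (tangentProj I p).toLinearMap

variable [∀ x, AddCommGroup (V x)] [∀ x, Module ℝ (V x)] [VectorBundle ℝ F V]

/-- The vertical lift of `q` at `p`, i.e. the velocity at `t = 0` of the curve `t ↦ p + t q` in the
fibre through `p`. -/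
def vlift (I : ModelWithCorners ℝ E H) (p : TotalSpace F V) (q : V p.proj) :
    TangentSpace (I.prod 𝓘(ℝ, F)) p :=
  mfderiv 𝓘(ℝ, ℝ) (I.prod 𝓘(ℝ, F))
    (fun t : ℝ => (⟨p.proj, p.snd + t • q⟩ : TotalSpace F V)) 0 (1 : ℝ)

lemma vlift_eq (p : TotalSpace F V) (q : V p.proj) :
    (vlift I p q : E × F) =
      (0, (trivializationAt F V p.proj).continuousLinearMapAt ℝ p.proj q) := by
  set e := trivializationAt F V p.proj
  have he : p.proj ∈ e.baseSet := mem_baseSet_trivializationAt F V p.proj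
  have hc : (fun t : ℝ => (e (⟨p.proj, p.snd + t • q⟩ : TotalSpace F V)).2)
      = fun t : ℝ => e.continuousLinearMapAt ℝ p.proj p.snd
          + t • e.continuousLinearMapAt ℝ p.proj q := by
    ext t
    rw [← map_smul, ← map_add, e.continuousLinearMapAt_apply ℝ, Trivialization.linearMapAt_apply (R := ℝ), if_pos he]
  have hd : HasMFDerivAt 𝓘(ℝ, ℝ) 𝓘(ℝ, F)
      (fun t : ℝ => (e (⟨p.proj, p.snd + t • q⟩ : TotalSpace F V)).2) 0
      ((1 : ℝ →L[ℝ] ℝ).smulRight (e.continuousLinearMapAt ℝ p.proj q)) := by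
    rw [hc]
    exact (((hasFDerivAt_id (𝕜 := ℝ) (0 : ℝ)).smul_const _).const_add _).hasMFDerivAt
  have hdiff : MDifferentiableAt 𝓘(ℝ, ℝ) (I.prod 𝓘(ℝ, F))
      (fun t : ℝ => (⟨p.proj, p.snd + t • q⟩ : TotalSpace F V)) 0 :=
    (mdifferentiableAt_totalSpace I _).2 ⟨mdifferentiableAt_const, hd.mdifferentiableAt⟩
  refine (mfderiv_totalSpace hdiff (1 : ℝ)).trans ?_
  refine Prod.ext ?_ ?_
  · change mfderiv 𝓘(ℝ, ℝ) I (fun _ : ℝ => p.proj) 0 (1 : ℝ) = 0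
    rw [mfderiv_const]
    rfl
  · change mfderiv 𝓘(ℝ, ℝ) 𝓘(ℝ, F)
      (fun t : ℝ => (e (⟨p.proj, p.snd + t • q⟩ : TotalSpace F V)).2) 0 (1 : ℝ) = _
    rw [hd.mfderiv]
    exact one_smul ℝ _

lemma vlift_mem_ver (p : TotalSpace F V) (q : V p.proj) :
    vlift I p q ∈ ver I p := by
  rw [ver, LinearMap.mem_ker]
  exact (tangentProj_apply p _).trans (congrArg Prod.fst (vlift_eq (I := I) p q))

/-- The vertical lift at `p`, as a linear map from the fibre to the vertical space. -/
def vlLinear (I : ModelWithCorners ℝ E H) (p : TotalSpace F V) :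
    V p.proj →ₗ[ℝ] ver I p where
  toFun q := ⟨vlift I p q, vlift_mem_ver p q⟩
  map_add' q q' := by
    have h : (vlift I p (q + q') : E × F) = (vlift I p q : E × F) + (vlift I p q' : E × F) := by
      rw [vlift_eq, vlift_eq, vlift_eq]
      exact Prod.ext (add_zero (0 : E)).symm (map_add _ q q')
    exact Subtype.ext h
  map_smul' c q := by
    have h : (vlift I p (c • q) : E × F) = c • (vlift I p q : E × F) := by
      rw [vlift_eq, vlift_eq]
      exact Prod.ext (smul_zero (A := E) c).symm (map_smul _ c q)
    exact Subtype.ext h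

lemma vlLinear_bijective (p : TotalSpace F V) :
    Function.Bijective (vlLinear I p) := by
  have he : p.proj ∈ (trivializationAt F V p.proj).baseSet := mem_baseSet_trivializationAt F V _
  set e := (trivializationAt F V p.proj).continuousLinearEquivAt ℝ p.proj he with hE
  have hvl : ∀ q, (vlift I p q : E × F) = (0, e q) := fun q => by
    rw [vlift_eq, hE, Trivialization.coe_continuousLinearEquivAt_eq,
      Trivialization.continuousLinearMapAt_apply]
  refine ⟨fun q q' h => ?_, fun ξ => ⟨e.symm (Prod.snd (α := E) (β := F) ξ.1), ?_⟩⟩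
  · have h1 : (vlift I p q : E × F) = vlift I p q' := congrArg Subtype.val h
    rw [hvl, hvl] at h1
    have h2 : e q = e q' := congrArg (fun z : E × F => z.2) h1
    exact e.injective h2
  · refine Subtype.ext ((hvl _).trans ?_)
    have h1 := (tangentProj_apply p ξ.1).symm.trans (LinearMap.mem_ker.1 ξ.2)
    exact Prod.ext h1.symm (e.apply_symm_apply _)

/-- The vertical lift is a linear isomorphism from the fibre onto the vertical space. -/
def vl (I : ModelWithCorners ℝ E H) (p : TotalSpace F V) :
    V p.proj ≃ₗ[ℝ] ver I p :=
  LinearEquiv.ofBijective (vlLinear I p) (vlLinear_bijective p)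

lemma coe_vl (p : TotalSpace F V) (q : V p.proj) :
    (vl I p q : TangentSpace (I.prod 𝓘(ℝ, F)) p) = vlift I p q := rfl

end Vertical

variable [IsManifold I ∞ M]

/-- The cotangent space `T*_x M`. -/
abbrev CotangentSpace (I : ModelWithCorners ℝ E H) {M : Type*} [TopologicalSpace M]
    [ChartedSpace H M] (x : M) : Type _ := TangentSpace I x →L[ℝ] ℝ

/-- The cotangent bundle `T*M`, with Mathlib's vector bundle and manifold structures. -/
abbrev CotangentBundle (I : ModelWithCorners ℝ E H) (M : Type*) [TopologicalSpace M]
    [ChartedSpace H M] [IsManifold I ∞ M] : Type _ :=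
  TotalSpace (E →L[ℝ] ℝ) (fun x : M => CotangentSpace I x)

/-- Smooth Riemannian metrics on `M`. -/
abbrev SmoothRiemannianMetric (I : ModelWithCorners ℝ E H) (M : Type*) [TopologicalSpace M]
    [ChartedSpace H M] [IsManifold I ∞ M] : Type _ :=
  ContMDiffRiemannianMetric I ∞ E (fun x : M => TangentSpace I x)

/-! ### The Levi-Civita connection -/

section LeviCivita

variable (g : SmoothRiemannianMetric I M)

/-- The function `x ↦ g_x(X, Y)`. -/
def metricPairing (X Y : Π x : M, TangentSpace I x) (x : M) : ℝ := g.inner x (X x) (Y x)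

lemma metricPairing_comm (X Y : Π x : M, TangentSpace I x) :
    metricPairing g X Y = metricPairing g Y X := by
  ext y; exact g.symm y _ _

lemma metricPairing_smul (f : M → ℝ) (X Y : Π x : M, TangentSpace I x) :
    metricPairing g (f • X) Y = f * metricPairing g X Y := by
  ext y; simp [metricPairing]

lemma metricPairing_add (X X' Y : Π x : M, TangentSpace I x) :
    metricPairing g (X + X') Y = metricPairing g X Y + metricPairing g X' Y := by
  ext y; simp [metricPairing]

lemma mdifferentiableAt_metricPairing {X Y : Π x : M, TangentSpace I x} {x : M}
    (hX : MDiffAt (T% X) x) (hY : MDiffAt (T% Y) x) : MDiffAt (metricPairing g X Y) x := by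
  have h1 := (g.contMDiff.contMDiffAt (x := x)).mdifferentiableAt (by simp)
  have := MDifferentiableAt.clm_bundle_apply₂ (F₁ := E) (F₂ := E) (F₃ := ℝ)
    (E₁ := fun x : M => TangentSpace I x) (E₂ := fun x : M => TangentSpace I x)
    (E₃ := Bundle.Trivial M ℝ) (b := fun y => y) (ψ := g.inner) (v := X) (w := Y) h1 hX hY
  rw [mdifferentiableAt_totalSpace] at this
  exact this.2

lemma d_smul_left {f : M → ℝ} {X Y : Π x : M, TangentSpace I x} {x : M} (hf : MDiffAt f x)
    (hX : MDiffAt (T% X) x) (hY : MDiffAt (T% Y) x) (u : TangentSpace I x) :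
    d% (metricPairing g (f • X) Y) x u
      = f x * d% (metricPairing g X Y) x u + d% f x u * g.inner x (X x) (Y x) := by
  rw [metricPairing_smul, mvfderiv_mul hf (mdifferentiableAt_metricPairing g hX hY)]
  simp [metricPairing, mul_comm]

lemma d_smul_right {f : M → ℝ} {X Y : Π x : M, TangentSpace I x} {x : M} (hf : MDiffAt f x)
    (hX : MDiffAt (T% X) x) (hY : MDiffAt (T% Y) x) (u : TangentSpace I x) :
    d% (metricPairing g X (f • Y)) x u
      = f x * d% (metricPairing g X Y) x u + d% f x u * g.inner x (X x) (Y x) := by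
  rw [metricPairing_comm g X, d_smul_left g hf hY hX, metricPairing_comm g X, g.symm x (X x)]

lemma d_add_left {X X' Y : Π x : M, TangentSpace I x} {x : M} (hX : MDiffAt (T% X) x)
    (hX' : MDiffAt (T% X') x) (hY : MDiffAt (T% Y) x) (u : TangentSpace I x) :
    d% (metricPairing g (X + X') Y) x u
      = d% (metricPairing g X Y) x u + d% (metricPairing g X' Y) x u := by
  rw [metricPairing_add, mvfderiv_add (mdifferentiableAt_metricPairing g hX hY)
    (mdifferentiableAt_metricPairing g hX' hY)]
  simp

lemma d_add_right {X Y Y' : Π x : M, TangentSpace I x} {x : M} (hX : MDiffAt (T% X) x)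
    (hY : MDiffAt (T% Y) x) (hY' : MDiffAt (T% Y') x) (u : TangentSpace I x) :
    d% (metricPairing g X (Y + Y')) x u
      = d% (metricPairing g X Y) x u + d% (metricPairing g X Y') x u := by
  rw [metricPairing_comm g X, d_add_left g hY hY' hX, metricPairing_comm g X,
    metricPairing_comm g X]

variable [FiniteDimensional ℝ E]

lemma metric_nondegenerate (x : M) {v v' : TangentSpace I x}
    (h : ∀ w, g.inner x v w = g.inner x v' w) : v = v' := by
  by_contra hne
  have h1 := g.pos x (v - v') (sub_ne_zero.2 hne)
  have h2 : g.inner x (v - v') (v - v') = 0 := by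
    rw [map_sub (g.inner x) v v', sub_apply, h, sub_self]
  exact h1.ne' h2

/-- The linear isomorphism `T_x M → T*_x M` given by the Riemannian metric. -/
def flatEquiv (x : M) : TangentSpace I x ≃ₗ[ℝ] CotangentSpace I x :=
  haveI : FiniteDimensional ℝ (TangentSpace I x) := inferInstanceAs (FiniteDimensional ℝ E)
  haveI : T2Space (TangentSpace I x) := inferInstanceAs (T2Space E)
  haveI : FiniteDimensional ℝ (CotangentSpace I x) :=
    inferInstanceAs (FiniteDimensional ℝ (E →L[ℝ] ℝ))
  LinearEquiv.ofInjectiveOfFinrankEq (g.inner x : TangentSpace I x →ₗ[ℝ] CotangentSpace I x)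
    (fun _ _ h => metric_nondegenerate g x fun w => congrArg (fun f : CotangentSpace I x => f w) h)
    (by
      rw [← (LinearMap.toContinuousLinearMap (𝕜 := ℝ) (E := TangentSpace I x)
        (F' := ℝ)).finrank_eq]
      exact (Subspace.dual_finrank_eq).symm)

lemma flatEquiv_apply (x : M) (v : TangentSpace I x) : flatEquiv g x v = g.inner x v := rfl

/-- The right-hand side of the Koszul formula, i.e. the value at `x` of
`½ (U g(X,W) + X g(U,W) - W g(U,X) + g([U,X],W) - g([U,W],X) - g([X,W],U))`. -/
def koszul (X U W : Π x : M, TangentSpace I x) (x : M) : ℝ :=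
  2⁻¹ * (d% (metricPairing g X W) x (U x) + d% (metricPairing g U W) x (X x)
    - d% (metricPairing g U X) x (W x) + g.inner x (mlieBracket I U X x) (W x)
    - g.inner x (mlieBracket I U W x) (X x) - g.inner x (mlieBracket I X W x) (U x))

lemma koszul_tensorial_left {X W : Π x : M, TangentSpace I x} {x : M}
    (hX : MDiffAt (T% X) x) (hW : MDiffAt (T% W) x) :
    TensorialAt I E (fun U => koszul g X U W x) x where
  smul {f U} hf hU := by
    simp only [koszul, d_smul_left g hf hU hX, d_smul_left g hf hU hW,
      mlieBracket_smul_left hf hU, Pi.smul_apply', map_add, map_smul, map_neg,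
      add_apply, smul_apply, smul_eq_mul, neg_smul, neg_apply]
    ring
  add {U U'} hU hU' := by
    simp only [koszul, d_add_left g hU hU' hX, d_add_left g hU hU' hW,
      mlieBracket_add_left hU hU', Pi.add_apply, map_add, add_apply]
    ring

lemma koszul_tensorial_right {X U : Π x : M, TangentSpace I x} {x : M}
    (hX : MDiffAt (T% X) x) (hU : MDiffAt (T% U) x) :
    TensorialAt I E (fun W => koszul g X U W x) x where
  smul {f W} hf hW := by
    simp only [koszul, d_smul_right g hf hU hW, d_smul_right g hf hX hW,
      mlieBracket_smul_right hf hW, Pi.smul_apply', map_add, map_smul,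
      add_apply, smul_apply, smul_eq_mul]
    rw [g.symm x (W x) (X x), g.symm x (W x) (U x)]
    ring
  add {W W'} hW hW' := by
    simp only [koszul, d_add_right g hU hW hW', d_add_right g hX hW hW',
      mlieBracket_add_right hW hW', Pi.add_apply, map_add, add_apply]
    ring

open Classical in
/-- `∇ X` at `x`, for a vector field `X` that is differentiable at `x`, is defined by the Koszul
formula `g(∇_U X, W) = koszul X U W`. -/
def leviCivitaAux (X : Π x : M, TangentSpace I x) (x : M) :
    TangentSpace I x →L[ℝ] TangentSpace I x :=
  haveI : FiniteDimensional ℝ (TangentSpace I x) := inferInstanceAs (FiniteDimensional ℝ E)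
  haveI : T2Space (TangentSpace I x) := inferInstanceAs (T2Space E)
  if hX : MDiffAt (T% X) x then
    LinearMap.toContinuousLinearMap ((flatEquiv g x).symm.toLinearMap ∘ₗ
      (TensorialAt.mkHom₂ (fun U W => koszul g X U W x) x
        (fun _ hW => koszul_tensorial_left g hX hW)
        (fun _ hU => koszul_tensorial_right g hX hU)).toLinearMap)
  else 0

lemma inner_leviCivitaAux {X U W : Π x : M, TangentSpace I x} {x : M} (hX : MDiffAt (T% X) x)
    (hU : MDiffAt (T% U) x) (hW : MDiffAt (T% W) x) :
    g.inner x (leviCivitaAux g X x (U x)) (W x) = koszul g X U W x := by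
  rw [← flatEquiv_apply, leviCivitaAux, dif_pos hX]
  simp only [LinearMap.coe_toContinuousLinearMap', LinearMap.comp_apply, LinearEquiv.coe_coe,
    LinearEquiv.apply_symm_apply]
  exact TensorialAt.mkHom₂_apply (fun _ hW => koszul_tensorial_left g hX hW)
        (fun _ hU => koszul_tensorial_right g hX hU) hU hW

/-- The Levi-Civita connection `∇` of the metric `g`; `leviCivita g X x u` is `(∇_u X)(x)`. -/
def leviCivita : CovariantDerivative I E (TangentSpace I : M → Type _) where
  toFun := leviCivitaAux g
  isCovariantDerivativeOnUniv :=
    { add := by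
        intro X X' x hX hX' _
        ext u
        refine metric_nondegenerate g x fun w => ?_
        have hu := mdifferentiableAt_extend I E u
        have hw := mdifferentiableAt_extend I E w
        have h1 := inner_leviCivitaAux g (mdifferentiableAt_add_section hX hX') hu hw
        have h2 := inner_leviCivitaAux g hX hu hw
        have h3 := inner_leviCivitaAux g hX' hu hw
        simp only [extend_apply_self] at h1 h2 h3
        rw [add_apply, map_add, add_apply, h2, h3]
        refine h1.trans ?_
        simp only [koszul, d_add_left g hX hX' hw, d_add_right g hu hX hX',
          mlieBracket_add_left hX hX', mlieBracket_add_right hX hX', Pi.add_apply, map_add,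
          add_apply]
        ring
      leibniz := by
        intro X f x hX hf _
        ext u
        refine metric_nondegenerate g x fun w => ?_
        have hu := mdifferentiableAt_extend I E u
        have hw := mdifferentiableAt_extend I E w
        have h1 := inner_leviCivitaAux g (hf.smul_section hX) hu hw
        have h2 := inner_leviCivitaAux g hX hu hw
        simp only [extend_apply_self] at h1 h2
        rw [add_apply, map_add, add_apply, smul_apply, map_smul, smul_apply, h2]
        refine h1.trans ?_
        simp only [koszul, d_smul_left g hf hX hw, d_smul_right g hf hu hX,
          mlieBracket_smul_left hf hX, mlieBracket_smul_right hf hX, Pi.smul_apply', map_add,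
          map_smul, map_neg, add_apply, smul_apply, smul_eq_mul, neg_smul, neg_apply,
          extend_apply_self, ContinuousLinearMap.smulRight_apply]
        rw [g.symm x u (X x)]
        ring }

/-- The Levi-Civita connection is compatible with the metric. -/
lemma leviCivita_metric {X Y : Π x : M, TangentSpace I x} {x : M} (hX : MDiffAt (T% X) x)
    (hY : MDiffAt (T% Y) x) (u : TangentSpace I x) :
    d% (metricPairing g X Y) x u
      = g.inner x (leviCivita g X x u) (Y x) + g.inner x (X x) (leviCivita g Y x u) := by
  have hu := mdifferentiableAt_extend I E u
  have h1 := inner_leviCivitaAux g hX hu hY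
  have h2 := inner_leviCivitaAux g hY hu hX
  have h3 := g.symm x (X x) (leviCivita g Y x u)
  rw [extend_apply_self] at h1 h2
  rw [h3]
  refine Eq.trans ?_ (congrArg₂ (· + ·) h1.symm h2.symm)
  rw [koszul, koszul, metricPairing_comm g Y X, mlieBracket_swap_apply (V := Y) (W := X),
    extend_apply_self]
  simp only [map_neg, neg_apply]
  ring

/-- The Levi-Civita connection is torsion-free. -/
lemma leviCivita_torsion : (leviCivita g).torsion = 0 := by
  rw [CovariantDerivative.torsion_eq_zero_iff]
  intro X Y x hX hY
  refine metric_nondegenerate g x fun w => ?_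
  have hw := mdifferentiableAt_extend I E w
  have h1 := inner_leviCivitaAux g hY hX hw
  have h2 := inner_leviCivitaAux g hX hY hw
  rw [extend_apply_self] at h1 h2
  rw [map_sub, sub_apply]
  refine (congrArg₂ (· - ·) h1 h2).trans ?_
  rw [koszul, koszul, metricPairing_comm g Y X, mlieBracket_swap_apply (V := Y) (W := X),
    extend_apply_self]
  simp only [map_neg, neg_apply]
  ring

end LeviCivita

/-! ### Horizontal spaces and the connector -/

section Horizontal

variable (g : SmoothRiemannianMetric I M) [FiniteDimensional ℝ E]

/-- The derivative `T_x X : T_x M → T_v TM` of a vector field `X` with `X x = v`. -/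
def tangentSection (v : TangentBundle I M) (X : Π x : M, TangentSpace I x) :
    TangentSpace I v.proj →L[ℝ] TangentSpace (I.prod 𝓘(ℝ, E)) v :=
  mfderiv I (I.prod 𝓘(ℝ, E)) (fun x => (⟨x, X x⟩ : TangentBundle I M)) v.proj

/-- `u ↦ T_x X (u) - vl_v (∇_u X)`, where `X` is a vector field with `X x = v`. -/
def hliftAux (v : TangentBundle I M) (X : Π x : M, TangentSpace I x) :
    TangentSpace I v.proj →ₗ[ℝ] TangentSpace (I.prod 𝓘(ℝ, E)) v :=
  (tangentSection v X).toLinearMap -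
    (ver I v).subtype ∘ₗ (vl I v).toLinearMap ∘ₗ (leviCivita g X v.proj).toLinearMap

lemma hliftAux_apply (v : TangentBundle I M) {X : Π x : M, TangentSpace I x}
    (hX : MDiffAt (T% X) v.proj) (u : TangentSpace I v.proj) :
    (hliftAux g v X u : E × E) = (u,
      d% (fun y => (trivializationAt E (TangentSpace I) v.proj (X y : TangentBundle I M)).2) v.proj u
      - (trivializationAt E (TangentSpace I) v.proj).continuousLinearMapAt ℝ v.proj
        (leviCivita g X v.proj u)) := by
  have h1 := mfderiv_totalSpace hX u
  have h2 := vlift_eq (I := I) v (leviCivita g X v.proj u)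
  refine (congrArg₂ (fun a b : E × E => a - b) h1 h2).trans ?_
  refine Prod.ext ?_ rfl
  change mfderiv I I (fun y : M => y) v.proj u - 0 = u
  rw [sub_zero]
  exact congrArg (fun f => f u) (mfderiv_id (I := I) (x := v.proj))

lemma tensorial_hlift (x : M) (u : TangentSpace I x) :
    TensorialAt I E (fun X : Π x : M, TangentSpace I x =>
      d% (fun y => (trivializationAt E (TangentSpace I) x (X y : TangentBundle I M)).2) x u
      - (trivializationAt E (TangentSpace I) x).continuousLinearMapAt ℝ x
        (leviCivita g X x u)) x := by
  set e := trivializationAt E (TangentSpace I : M → Type _) x with he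
  have hx : x ∈ e.baseSet := mem_baseSet_trivializationAt E _ x
  have hb : e.baseSet ∈ 𝓝 x := e.open_baseSet.mem_nhds hx
  constructor
  · intro f X hf hX
    have hX' := (mdifferentiableAt_section I X).1 hX
    have h1 : (fun y => (e ((f • X) y : TangentBundle I M)).2)
        =ᶠ[𝓝 x] f • (fun y => (e (X y : TangentBundle I M)).2) := by
      filter_upwards [hb] with y hy
      exact (e.linear ℝ hy).map_smul (f y) (X y)
    have h2 : d% (fun y => (e ((f • X) y : TangentBundle I M)).2) x
        = d% (f • (fun y => (e (X y : TangentBundle I M)).2)) x := by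
      rw [mvfderiv, mvfderiv]
      ext w
      have := h1.mfderiv_eq (I := I) (I' := 𝓘(ℝ, E))
      exact congrArg (fun L : E →L[ℝ] E => L w) this
    have h3 := (leviCivita g).isCovariantDerivativeOnUniv.leibniz hX hf
    rw [h2, mvfderiv_smul hf hX', h3]
    have h4 : (trivializationAt E (TangentSpace I) x (X x : TangentBundle I M)).2
        = (trivializationAt E (TangentSpace I) x).continuousLinearMapAt ℝ x (X x) := by
      change (e (X x : TangentBundle I M)).2 = e.continuousLinearMapAt ℝ x (X x)
      rw [e.continuousLinearMapAt_apply ℝ, Trivialization.linearMapAt_apply (R := ℝ), if_pos hx]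
    simp only [add_apply, smul_apply, map_add, map_smul, ContinuousLinearMap.smulRight_apply, h4]
    module
  · intro X X' hX hX'
    have h0 := (mdifferentiableAt_section I X).1 hX
    have h0' := (mdifferentiableAt_section I X').1 hX'
    have h1 : (fun y => (e ((X + X') y : TangentBundle I M)).2)
        =ᶠ[𝓝 x] (fun y => (e (X y : TangentBundle I M)).2)
          + (fun y => (e (X' y : TangentBundle I M)).2) := by
      filter_upwards [hb] with y hy
      exact (e.linear ℝ hy).map_add (X y) (X' y)
    have h2 : d% (fun y => (e ((X + X') y : TangentBundle I M)).2) x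
        = d% ((fun y => (e (X y : TangentBundle I M)).2)
          + (fun y => (e (X' y : TangentBundle I M)).2)) x := by
      rw [mvfderiv, mvfderiv]
      ext w
      have := h1.mfderiv_eq (I := I) (I' := 𝓘(ℝ, E))
      exact congrArg (fun L : E →L[ℝ] E => L w) this
    have h3 := (leviCivita g).isCovariantDerivativeOnUniv.add hX hX'
    rw [h2, mvfderiv_add h0 h0', h3]
    simp only [add_apply, map_add]
    module

/-- The horizontal lift `T_x M → T_v TM` at `v ∈ T_x M` for the Levi-Civita connection,
`u ↦ T_x X (u) - vl_v (∇_u X)`, where `X` is any vector field with `X x = v` that is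
differentiable at `x`; see `hlift_eq` for the independence of `X`. -/
def hlift (v : TangentBundle I M) :
    TangentSpace I v.proj →ₗ[ℝ] TangentSpace (I.prod 𝓘(ℝ, E)) v :=
  hliftAux g v (extend E v.snd)

lemma hlift_eq (v : TangentBundle I M) {X : Π x : M, TangentSpace I x}
    (hX : MDiffAt (T% X) v.proj) (hv : X v.proj = v.snd) : hlift g v = hliftAux g v X := by
  have hE := mdifferentiableAt_extend I E v.snd
  ext u
  refine (hliftAux_apply g v hE u).trans (Eq.trans ?_ (hliftAux_apply g v hX u).symm)
  exact Prod.ext rfl ((tensorial_hlift g v.proj u).pointwise hE hX (by simp [hv]))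

/-- The horizontal space `Hor(g)` at `v ∈ TM` of the Levi-Civita connection. -/
def hor (v : TangentBundle I M) : Submodule ℝ (TangentSpace (I.prod 𝓘(ℝ, E)) v) :=
  LinearMap.range (hlift g v)

lemma tangentProj_hlift (v : TangentBundle I M) (u : TangentSpace I v.proj) :
    tangentProj I v (hlift g v u) = u := by
  refine (tangentProj_apply v _).trans ?_
  exact congrArg Prod.fst (hliftAux_apply g v (mdifferentiableAt_extend I E v.snd) u)

/-- The metric as a map `TM → T*M` of bundles. -/
def flat (v : TangentBundle I M) : CotangentBundle I M := ⟨v.proj, g.inner v.proj v.snd⟩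

lemma mdifferentiable_flat :
    MDifferentiable (I.prod 𝓘(ℝ, E)) (I.prod 𝓘(ℝ, E →L[ℝ] ℝ)) (flat g) := by
  intro v
  have h1 : MDifferentiableAt I (I.prod 𝓘(ℝ, E →L[ℝ] E →L[ℝ] ℝ))
      (fun b => TotalSpace.mk' (E →L[ℝ] E →L[ℝ] ℝ) b (g.inner b)) v.proj :=
    (g.contMDiff.contMDiffAt (x := v.proj)).mdifferentiableAt (by simp)
  have h2 := h1.comp v (mdifferentiableAt_proj (IB := I) (TangentSpace I) (p := v))
  exact MDifferentiableAt.clm_bundle_apply (F₁ := E) (F₂ := E →L[ℝ] ℝ)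
    (E₁ := fun x : M => TangentSpace I x) (E₂ := fun x : M => CotangentSpace I x)
    (b := fun w : TangentBundle I M => w.proj) (ϕ := fun w => g.inner w.proj)
    (v := fun w => w.snd) h2 mdifferentiableAt_id

lemma flat_injective : Function.Injective (flat g) := by
  rintro ⟨x, v⟩ ⟨y, w⟩ h
  obtain rfl : x = y := congrArg TotalSpace.proj h
  have h' : g.inner x v = g.inner x w := TotalSpace.mk_injective x h
  rw [metric_nondegenerate g x (v := v) (v' := w) fun z => by rw [h']]

lemma flat_surjective : Function.Surjective (flat g) := fun α =>
  ⟨⟨α.proj, (flatEquiv g α.proj).symm α.snd⟩, by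
    change TotalSpace.mk α.proj (flatEquiv g α.proj ((flatEquiv g α.proj).symm α.snd)) = α
    rw [LinearEquiv.apply_symm_apply]⟩

lemma tangentProj_mfderiv_flat (v : TangentBundle I M)
    (ξ : TangentSpace (I.prod 𝓘(ℝ, E)) v) :
    tangentProj I (flat g v) (mfderiv (I.prod 𝓘(ℝ, E)) (I.prod 𝓘(ℝ, E →L[ℝ] ℝ)) (flat g) v ξ)
      = tangentProj I v ξ := by
  have h := mfderiv_comp v (I'' := I)
    (mdifferentiableAt_proj (IB := I) (CotangentSpace I : M → Type _) (p := flat g v))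
    (mdifferentiable_flat g v)
  exact (congrArg (fun f => f ξ) h).symm

/-- The horizontal space `Hor*(g) = T♭(Hor(g))` at `α ∈ T*M` of the induced connection on `T*M`. -/
def horStar (α : CotangentBundle I M) :
    Submodule ℝ (TangentSpace (I.prod 𝓘(ℝ, E →L[ℝ] ℝ)) α) where
  carrier := {ζ | ∃ v : TangentBundle I M, ∃ ξ ∈ hor g v,
    tangentMap (I.prod 𝓘(ℝ, E)) (I.prod 𝓘(ℝ, E →L[ℝ] ℝ)) (flat g) ⟨v, ξ⟩ = ⟨α, ζ⟩}
  add_mem' := by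
    rintro _ _ ⟨v, ξ, hξ, h⟩ ⟨v', ξ', hξ', h'⟩
    obtain rfl : flat g v = α := congrArg TotalSpace.proj h
    obtain rfl : v' = v := flat_injective g (congrArg TotalSpace.proj h')
    refine ⟨v', ξ + ξ', add_mem hξ hξ', ?_⟩
    rw [← TotalSpace.mk_injective _ h, ← TotalSpace.mk_injective _ h']
    exact congrArg (TotalSpace.mk _) (ContinuousLinearMap.map_add _ _ _)
  zero_mem' := by
    obtain ⟨v, rfl⟩ := flat_surjective g α
    exact ⟨v, 0, zero_mem _, congrArg (TotalSpace.mk _) (ContinuousLinearMap.map_zero _)⟩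
  smul_mem' := by
    rintro c _ ⟨v, ξ, hξ, h⟩
    obtain rfl : flat g v = α := congrArg TotalSpace.proj h
    refine ⟨v, c • ξ, Submodule.smul_mem _ c hξ, ?_⟩
    rw [← TotalSpace.mk_injective _ h]
    exact congrArg (TotalSpace.mk _) (ContinuousLinearMap.map_smul _ _ _)

/-- The splitting `TT*M = Ver ⊕ Hor*(g)`. -/
lemma isCompl_ver_horStar (α : CotangentBundle I M) : IsCompl (ver I α) (horStar g α) := by
  obtain ⟨v, rfl⟩ := flat_surjective g α
  have key : ∀ u, tangentProj I (flat g v) (mfderiv (I.prod 𝓘(ℝ, E)) (I.prod 𝓘(ℝ, E →L[ℝ] ℝ))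
      (flat g) v (hlift g v u)) = u := fun u => by
    rw [tangentProj_mfderiv_flat]; exact tangentProj_hlift g v u
  rw [isCompl_iff]
  constructor
  · rw [Submodule.disjoint_def]
    rintro ζ hζ ⟨v', ξ, ⟨u, rfl⟩, h⟩
    obtain rfl : v' = v := flat_injective g (congrArg TotalSpace.proj h)
    obtain rfl := TotalSpace.mk_injective _ h
    have h0 : u = 0 := (key u).symm.trans hζ
    rw [h0]
    refine (congrArg _ (LinearMap.map_zero (hlift g v'))).trans (ContinuousLinearMap.map_zero _)
  · rw [codisjoint_iff, eq_top_iff]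
    rintro ζ -
    rw [Submodule.mem_sup]
    set ζ' := mfderiv (I.prod 𝓘(ℝ, E)) (I.prod 𝓘(ℝ, E →L[ℝ] ℝ)) (flat g) v
      (hlift g v (tangentProj I (flat g v) ζ)) with hζ'
    refine ⟨ζ - ζ', ?_, ζ', ⟨v, _, ⟨_, rfl⟩, rfl⟩, sub_add_cancel _ _⟩
    rw [ver, LinearMap.mem_ker]
    refine (map_sub (tangentProj I (flat g v)) ζ ζ').trans ?_
    exact sub_eq_zero.2 (key _).symm

/-- The connector `K* : TT*M → T*M`, i.e. the projection onto the vertical space along `Hor*(g)`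
followed by the inverse of the vertical lift. -/
def connectorStar (α : CotangentBundle I M) :
    TangentSpace (I.prod 𝓘(ℝ, E →L[ℝ] ℝ)) α →ₗ[ℝ] CotangentSpace I α.proj :=
  (vl I α).symm.toLinearMap ∘ₗ
    (ver I α).projectionOnto (horStar g α) (isCompl_ver_horStar g α)

end Horizontal

/-! ### Differential forms and the canonical symplectic form -/

section Symplectic

/-- The exterior derivative of a differential `k`-form on a manifold: the form is pulled back to the
model vector space by the inverse of the preferred chart at the point, differentiated there, and
pulled back to the manifold. -/
def mextDeriv {E' : Type*} [NormedAddCommGroup E'] [NormedSpace ℝ E'] {H' : Type*}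
    [TopologicalSpace H'] (J : ModelWithCorners ℝ E' H') {N : Type*} [TopologicalSpace N]
    [ChartedSpace H' N] {k : ℕ} (β : Π p : N, TangentSpace J p [⋀^Fin k]→L[ℝ] ℝ) (p : N) :
    TangentSpace J p [⋀^Fin (k + 1)]→L[ℝ] ℝ :=
  (extDerivWithin
    (fun y : E' => (β ((extChartAt J p).symm y)).compContinuousLinearMap
      (mfderivWithin 𝓘(ℝ, E') J (extChartAt J p).symm (Set.range J) y))
    (Set.range J) (extChartAt J p p)).compContinuousLinearMap
      (mfderiv J 𝓘(ℝ, E') (extChartAt J p) p)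

/-- The Liouville form `θ` on `T*M`, `θ_α (ξ) = ⟨α, Tτ (ξ)⟩`. -/
def liouvilleForm (I : ModelWithCorners ℝ E H) (M : Type*) [TopologicalSpace M] [ChartedSpace H M]
    [IsManifold I ∞ M] (α : CotangentBundle I M) :
    TangentSpace (I.prod 𝓘(ℝ, E →L[ℝ] ℝ)) α [⋀^Fin 1]→L[ℝ] ℝ :=
  ContinuousAlternatingMap.ofSubsingleton ℝ _ _ (0 : Fin 1) (α.snd ∘L tangentProj I α)

/-- The canonical symplectic form `Ω = -dθ` on `T*M`. -/
def canonicalSymplecticForm (I : ModelWithCorners ℝ E H) (M : Type*) [TopologicalSpace M]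
    [ChartedSpace H M] [IsManifold I ∞ M] (α : CotangentBundle I M) :
    TangentSpace (I.prod 𝓘(ℝ, E →L[ℝ] ℝ)) α [⋀^Fin 2]→L[ℝ] ℝ :=
  -mextDeriv (I.prod 𝓘(ℝ, E →L[ℝ] ℝ)) (liouvilleForm I M) α

/-- `⟨A ∧ B⟩ (ξ, η) = ⟨A ξ, B η⟩ - ⟨A η, B ξ⟩` at `α ∈ T*M`, for linear maps
`A : T_α T*M → T_x M` and `B : T_α T*M → T*_x M`, where `x` is the foot point of `α`. -/
def wedgePairing {α : CotangentBundle I M}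
    (A : TangentSpace (I.prod 𝓘(ℝ, E →L[ℝ] ℝ)) α →ₗ[ℝ] TangentSpace I α.proj)
    (B : TangentSpace (I.prod 𝓘(ℝ, E →L[ℝ] ℝ)) α →ₗ[ℝ] CotangentSpace I α.proj)
    (ξ η : TangentSpace (I.prod 𝓘(ℝ, E →L[ℝ] ℝ)) α) : ℝ :=
  B η (A ξ) - B ξ (A η)

end Symplectic

end

end RiemannianCotangent

open RiemannianCotangent

namespace RiemannianCotangent

section

variable {E : Type*} [NormedAddCommGroup E] [NormedSpace ℝ E]
  {H : Type*} [TopologicalSpace H] {I : ModelWithCorners ℝ E H}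
  {M : Type*} [TopologicalSpace M] [ChartedSpace H M] [IsManifold I ∞ M]

lemma continuousLinearMapAt_trivializationAt_self (x : M) (u : TangentSpace I x) :
    (trivializationAt E (TangentSpace I : M → Type _) x).continuousLinearMapAt ℝ x u = u := by
  rw [TangentBundle.continuousLinearMapAt_trivializationAt (mem_chart_source H x),
    mfderiv_extChartAt_self]
  rfl

lemma symmL_trivializationAt_self (x : M) (u : E) :
    (trivializationAt E (TangentSpace I : M → Type _) x).symmL ℝ x u = u := by
  rw [TangentBundle.symmL_trivializationAt (mem_chart_source H x),
    mfderivWithin_range_extChartAt_symm]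
  rfl

lemma trivializationAt_cotangent_snd (x : M) (β : CotangentBundle I M) (w : E) :
    (trivializationAt (E →L[ℝ] ℝ) (CotangentSpace I : M → Type _) x β).2 w
      = β.snd ((trivializationAt E (TangentSpace I) x).symmL ℝ β.proj w) := by
  rw [hom_trivializationAt_apply, ContinuousLinearMap.inCoordinates]
  simp

/-- Vector fields with constant components in a chart commute. -/
lemma mlieBracket_extend {x : M} (u w : TangentSpace I x) :
    mlieBracket I (extend E u) (extend E w) x = 0 := by
  have key : ∀ v : TangentSpace I x, mpullbackWithin 𝓘(ℝ, E) I (extChartAt I x).symm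
      (extend E v) (Set.range I) =ᶠ[𝓝[Set.range I] (extChartAt I x x)] fun _ =>
        (trivializationAt E (TangentSpace I) x (⟨x, v⟩ : TangentBundle I M)).2 := by
    intro v
    filter_upwards [extChartAt_target_mem_nhdsWithin (I := I) x] with z hz
    have hs : (extChartAt I x).symm z ∈ (chartAt H x).source := by
      rw [← extChartAt_source I]; exact (extChartAt I x).map_target hz
    have h1 := TangentBundle.symmL_trivializationAt (I := I) hs
    rw [(extChartAt I x).right_inv hz] at h1
    rw [mpullbackWithin_apply]
    refine ((isInvertible_mfderivWithin_extChartAt_symm hz).inverse_apply_eq).2 ?_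
    rw [← h1]
    exact (Trivialization.symmL_apply (R := ℝ) _ (by simpa using hs) _).symm
  have hx : extChartAt I x x ∈ Set.range I := ⟨_, rfl⟩
  rw [← mlieBracketWithin_univ, mlieBracketWithin_apply, Set.preimage_univ, Set.univ_inter,
    (key u).lieBracketWithin_vectorField_eq_of_mem (key w) hx]
  simp only [lieBracketWithin, fderivWithin_fun_const, Pi.zero_apply, zero_apply, sub_self]
  exact map_zero _

/-- The Liouville form of a normed space `E`, i.e. the one-form `p dq` on `E × E'`. -/
noncomputable def modelLiouvilleForm (E : Type*) [NormedAddCommGroup E] [NormedSpace ℝ E]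
    (y : E × (E →L[ℝ] ℝ)) : (E × (E →L[ℝ] ℝ)) [⋀^Fin 1]→L[ℝ] ℝ :=
  ContinuousAlternatingMap.ofSubsingleton ℝ _ _ (0 : Fin 1)
    (y.2 ∘L ContinuousLinearMap.fst ℝ E (E →L[ℝ] ℝ))

lemma differentiable_ofSubsingleton {V W : Type*} [NormedAddCommGroup V] [NormedSpace ℝ V]
    [NormedAddCommGroup W] [NormedSpace ℝ W] {f : V → W →L[ℝ] ℝ} (hf : Differentiable ℝ f) :
    Differentiable ℝ fun y => ContinuousAlternatingMap.ofSubsingleton ℝ W ℝ (0 : Fin 1) (f y) :=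
  (ContinuousAlternatingMap.ofSubsingletonLIE (𝕜 := ℝ) (E := W) (F := ℝ)
    (0 : Fin 1)).toContinuousLinearEquiv.differentiable.comp hf

lemma differentiable_modelLiouvilleForm : Differentiable ℝ (modelLiouvilleForm E) :=
  differentiable_ofSubsingleton (by fun_prop)

lemma extDerivWithin_modelLiouvilleForm {s : Set (E × (E →L[ℝ] ℝ))} {y : E × (E →L[ℝ] ℝ)}
    (hs : UniqueDiffWithinAt ℝ s y) (v : Fin 2 → E × (E →L[ℝ] ℝ)) :
    extDerivWithin (modelLiouvilleForm E) s y v = (v 0).2 (v 1).1 - (v 1).2 (v 0).1 := by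
  have h : ∀ a b : E × (E →L[ℝ] ℝ),
      fderivWithin ℝ (fun z : E × (E →L[ℝ] ℝ) => z.2 a.1) s y b = b.2 a.1 := by
    intro a b
    have := (((ContinuousLinearMap.apply ℝ ℝ a.1) ∘L
      ContinuousLinearMap.snd ℝ E (E →L[ℝ] ℝ)).hasFDerivWithinAt (s := s) (x := y)).fderivWithin hs
    exact congrArg (fun L => L b) this
  rw [extDerivWithin_apply (differentiable_modelLiouvilleForm y).differentiableWithinAt hs,
    Fin.sum_univ_two]
  have h0 := h (v 1) (v 0)
  have h1 := h (v 0) (v 1)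
  simp only [Fin.val_zero, pow_zero, one_smul, Fin.val_one, pow_one, neg_smul, ← sub_eq_add_neg]
  exact congrArg₂ (· - ·) h0 h1

lemma extChartAt_cotangent_symm (α : CotangentBundle I M) {y : E × (E →L[ℝ] ℝ)}
    (hy : y ∈ (extChartAt (I.prod 𝓘(ℝ, E →L[ℝ] ℝ)) α).target) :
    ((extChartAt (I.prod 𝓘(ℝ, E →L[ℝ] ℝ)) α).symm y).proj ∈ (chartAt H α.proj).source ∧
      extChartAt I α.proj ((extChartAt (I.prod 𝓘(ℝ, E →L[ℝ] ℝ)) α).symm y).proj = y.1 ∧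
      (trivializationAt (E →L[ℝ] ℝ) (CotangentSpace I : M → Type _) α.proj
        ((extChartAt (I.prod 𝓘(ℝ, E →L[ℝ] ℝ)) α).symm y)).2 = y.2 := by
  have h1 := (extChartAt (I.prod 𝓘(ℝ, E →L[ℝ] ℝ)) α).right_inv hy
  have h2 := (extChartAt (I.prod 𝓘(ℝ, E →L[ℝ] ℝ)) α).map_target hy
  generalize (extChartAt (I.prod 𝓘(ℝ, E →L[ℝ] ℝ)) α).symm y = z at h1 h2 ⊢
  rw [FiberBundle.extChartAt] at h1 h2
  have h3 : z ∈ (trivializationAt (E →L[ℝ] ℝ) (CotangentSpace I : M → Type _) α.proj).source :=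
    h2.1
  have h4 : z.proj ∈ (chartAt H α.proj).source := by
    rw [Trivialization.mem_source, hom_trivializationAt_baseSet] at h3
    exact h3.1
  refine ⟨h4, ?_, congrArg Prod.snd h1⟩
  rw [← Trivialization.coe_fst _ h3]
  exact congrArg Prod.fst h1

lemma liouvilleForm_pullback (α : CotangentBundle I M) :
    (fun y => (liouvilleForm I M ((extChartAt (I.prod 𝓘(ℝ, E →L[ℝ] ℝ)) α).symm y)
      ).compContinuousLinearMap (mfderivWithin 𝓘(ℝ, E × (E →L[ℝ] ℝ)) (I.prod 𝓘(ℝ, E →L[ℝ] ℝ))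
        (extChartAt (I.prod 𝓘(ℝ, E →L[ℝ] ℝ)) α).symm
        (Set.range (I.prod 𝓘(ℝ, E →L[ℝ] ℝ))) y))
      =ᶠ[𝓝[Set.range (I.prod 𝓘(ℝ, E →L[ℝ] ℝ))] (extChartAt (I.prod 𝓘(ℝ, E →L[ℝ] ℝ)) α α)]
    modelLiouvilleForm E := by
  filter_upwards [extChartAt_target_mem_nhdsWithin (I := I.prod 𝓘(ℝ, E →L[ℝ] ℝ)) α] with y hy
  set J := I.prod 𝓘(ℝ, E →L[ℝ] ℝ) with hJ
  set z := (extChartAt J α).symm y with hz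
  have hyz : extChartAt J α z = y := (extChartAt J α).right_inv hy
  have hU : UniqueMDiffWithinAt 𝓘(ℝ, E × (E →L[ℝ] ℝ)) (Set.range J) y :=
    J.uniqueMDiffOn y (extChartAt_target_subset_range α hy)
  obtain ⟨hzs, hz1, hz2⟩ := extChartAt_cotangent_symm α hy
  ext v
  have hd : tangentProj I z (mfderivWithin 𝓘(ℝ, E × (E →L[ℝ] ℝ)) J (extChartAt J α).symm
      (Set.range J) y (v 0)) =
      (trivializationAt E (TangentSpace I) α.proj).symmL ℝ z.proj (v 0).1 := by
    have hp : MDifferentiableAt J I (TotalSpace.proj : CotangentBundle I M → M) z :=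
      mdifferentiableAt_proj (IB := I) (CotangentSpace I : M → Type _) (p := z)
    have hc := mfderiv_comp_mfderivWithin y hp (mdifferentiableWithinAt_extChartAt_symm hy) hU
    have hF : MDifferentiableWithinAt 𝓘(ℝ, E) I (extChartAt I α.proj).symm (Set.range I) y.1 := by
      refine mdifferentiableWithinAt_extChartAt_symm ?_
      rw [← hz1]
      exact (extChartAt I α.proj).map_source (by rwa [extChartAt_source])
    have hfst : HasMFDerivWithinAt 𝓘(ℝ, E × (E →L[ℝ] ℝ)) 𝓘(ℝ, E) Prod.fst (Set.range J) y
        (ContinuousLinearMap.fst ℝ E (E →L[ℝ] ℝ)) :=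
      (ContinuousLinearMap.fst ℝ E (E →L[ℝ] ℝ)).hasMFDerivWithinAt
    have hm : Set.range J ⊆ Prod.fst ⁻¹' Set.range I := by
      rintro _ ⟨w, rfl⟩
      exact ⟨w.1, rfl⟩
    have hc' := (hF.hasMFDerivWithinAt.comp y hfst hm).mfderivWithin hU
    have he : (TotalSpace.proj : CotangentBundle I M → M) ∘ (extChartAt J α).symm
        =ᶠ[𝓝[Set.range J] y] (extChartAt I α.proj).symm ∘ Prod.fst := by
      filter_upwards [extChartAt_target_mem_nhdsWithin_of_mem hy] with w hw
      obtain ⟨h1, h2, -⟩ := extChartAt_cotangent_symm α hw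
      simp only [Function.comp_apply]
      rw [← h2, (extChartAt I α.proj).left_inv (by rwa [extChartAt_source])]
    have he' := he.mfderivWithin_eq (I := 𝓘(ℝ, E × (E →L[ℝ] ℝ))) (I' := I)
      (he.self_of_nhdsWithin (extChartAt_target_subset_range α hy))
    rw [TangentBundle.symmL_trivializationAt hzs, hz1]
    have h := hc.symm.trans (he'.trans hc')
    exact congrArg (fun L : E × (E →L[ℝ] ℝ) →L[ℝ] E => L (v 0)) h
  change z.snd (tangentProj I z (mfderivWithin 𝓘(ℝ, E × (E →L[ℝ] ℝ)) J (extChartAt J α).symm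
      (Set.range J) y (v 0))) = y.2 (v 0).1
  rw [hd, ← trivializationAt_cotangent_snd, hz2]

lemma canonicalSymplecticForm_apply (α : CotangentBundle I M)
    (ξ η : TangentSpace (I.prod 𝓘(ℝ, E →L[ℝ] ℝ)) α) :
    canonicalSymplecticForm I M α ![ξ, η] =
      (Prod.snd (α := E) (β := E →L[ℝ] ℝ) η) (Prod.fst (α := E) (β := E →L[ℝ] ℝ) ξ)
       - (Prod.snd (α := E) (β := E →L[ℝ] ℝ) ξ) (Prod.fst (α := E) (β := E →L[ℝ] ℝ) η) := by
  have hx : extChartAt (I.prod 𝓘(ℝ, E →L[ℝ] ℝ)) α α ∈ Set.range (I.prod 𝓘(ℝ, E →L[ℝ] ℝ)) :=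
    ⟨_, rfl⟩
  have h := (liouvilleForm_pullback α).extDerivWithin_eq_of_mem hx
  have h2 : mextDeriv (I.prod 𝓘(ℝ, E →L[ℝ] ℝ)) (liouvilleForm I M) α ![ξ, η]
      = extDerivWithin (modelLiouvilleForm E) (Set.range (I.prod 𝓘(ℝ, E →L[ℝ] ℝ)))
        (extChartAt (I.prod 𝓘(ℝ, E →L[ℝ] ℝ)) α α) ![ξ, η] := by
    rw [mextDeriv, h, mfderiv_extChartAt_self]
    rfl
  rw [extDerivWithin_modelLiouvilleForm ((I.prod 𝓘(ℝ, E →L[ℝ] ℝ)).uniqueDiffOn _ hx)] at h2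
  exact (congrArg Neg.neg h2).trans (neg_sub _ _)

end

section

variable {E : Type*} [NormedAddCommGroup E] [NormedSpace ℝ E] [FiniteDimensional ℝ E]
  {H : Type*} [TopologicalSpace H] {I : ModelWithCorners ℝ E H}
  {M : Type*} [TopologicalSpace M] [ChartedSpace H M] [IsManifold I ∞ M]
  (g : SmoothRiemannianMetric I M)

lemma trivializationAt_snd_self (x : M) (w : TangentSpace I x) :
    (trivializationAt E (TangentSpace I) x (⟨x, w⟩ : TangentBundle I M)).2 = w := by
  have h := continuousLinearMapAt_trivializationAt_self x w
  rwa [Trivialization.continuousLinearMapAt_apply, Trivialization.linearMapAt_apply,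
    if_pos (mem_baseSet_trivializationAt E _ x)] at h

lemma trivializationAt_cotangent_snd_self (x : M) (β : CotangentSpace I x) (w : E) :
    (trivializationAt (E →L[ℝ] ℝ) (CotangentSpace I : M → Type _) x ⟨x, β⟩).2 w = β w := by
  rw [trivializationAt_cotangent_snd, symmL_trivializationAt_self]

lemma vlift_cotangent_snd (α : CotangentBundle I M) (q : CotangentSpace I α.proj) (w : E) :
    Prod.snd (α := E) (β := E →L[ℝ] ℝ) (vlift I α q) w = q w := by
  have h := congrArg (fun z : E × (E →L[ℝ] ℝ) => z.2 w) (vlift_eq (I := I) α q)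
  refine h.trans ?_
  have h2 := trivializationAt_cotangent_snd_self α.proj q w
  rw [← h2]
  refine congrArg (fun p : E →L[ℝ] ℝ => p w) ?_
  rw [Trivialization.continuousLinearMapAt_apply, Trivialization.linearMapAt_apply,
    if_pos (mem_baseSet_trivializationAt (E →L[ℝ] ℝ) _ α.proj)]

lemma mdifferentiableAt_fibre_line {F : Type*} [NormedAddCommGroup F] [NormedSpace ℝ F]
    {V : M → Type*} [TopologicalSpace (TotalSpace F V)] [∀ x, TopologicalSpace (V x)]
    [FiberBundle F V] [∀ x, AddCommGroup (V x)] [∀ x, Module ℝ (V x)] [VectorBundle ℝ F V]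
    (x : M) (p q : V x) (t₀ : ℝ) :
    MDifferentiableAt 𝓘(ℝ, ℝ) (I.prod 𝓘(ℝ, F))
      (fun t : ℝ => (⟨x, p + t • q⟩ : TotalSpace F V)) t₀ := by
  refine (mdifferentiableAt_totalSpace I _).2 ⟨mdifferentiableAt_const, ?_⟩
  set e := trivializationAt F V x
  have hx : x ∈ e.baseSet := mem_baseSet_trivializationAt F V x
  have hc : (fun t : ℝ => (e (⟨x, p + t • q⟩ : TotalSpace F V)).2)
      = fun t : ℝ => e.continuousLinearMapAt ℝ x p + t • e.continuousLinearMapAt ℝ x q := by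
    ext t
    rw [← map_smul, ← map_add, e.continuousLinearMapAt_apply ℝ,
      Trivialization.linearMapAt_apply (R := ℝ), if_pos hx]
  change MDifferentiableAt 𝓘(ℝ, ℝ) 𝓘(ℝ, F) (fun t : ℝ => (e (⟨x, p + t • q⟩ : TotalSpace F V)).2) t₀
  rw [hc, mdifferentiableAt_iff_differentiableAt]
  fun_prop

lemma leviCivita_extend_comm (x : M) (u w : TangentSpace I x) :
    leviCivita g (extend E w) x u = leviCivita g (extend E u) x w := by
  have hu := mdifferentiableAt_extend I E u
  have hw := mdifferentiableAt_extend I E w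
  have h := (CovariantDerivative.torsion_eq_zero_iff (leviCivita g)).1 (leviCivita_torsion g) hu hw
  rw [mlieBracket_extend] at h
  simpa only [extend_apply_self, sub_eq_zero] using h

lemma mfderiv_flat_congr {v v' : TangentBundle I M} (h : v = v') :
    (mfderiv (I.prod 𝓘(ℝ, E)) (I.prod 𝓘(ℝ, E →L[ℝ] ℝ)) (flat g) v :
      E × E →L[ℝ] E × (E →L[ℝ] ℝ)) =
    (mfderiv (I.prod 𝓘(ℝ, E)) (I.prod 𝓘(ℝ, E →L[ℝ] ℝ)) (flat g) v' :
      E × E →L[ℝ] E × (E →L[ℝ] ℝ)) := by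
  rw [h]

lemma mfderiv_flat_vlift (v : TangentBundle I M) (q : TangentSpace I v.proj) :
    mfderiv (I.prod 𝓘(ℝ, E)) (I.prod 𝓘(ℝ, E →L[ℝ] ℝ)) (flat g) v (vlift I v q)
      = vlift I (flat g v) (g.inner v.proj q) := by
  have hv : (⟨v.proj, v.snd + (0 : ℝ) • q⟩ : TangentBundle I M) = v := by
    rw [zero_smul, add_zero]
  have hd : MDifferentiableAt 𝓘(ℝ, ℝ) (I.prod 𝓘(ℝ, E))
      (fun t : ℝ => (⟨v.proj, v.snd + t • q⟩ : TangentBundle I M)) 0 :=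
    mdifferentiableAt_fibre_line _ _ _ _
  have h := mfderiv_comp_of_eq (mdifferentiable_flat g v) hd hv
  have h2 : flat g ∘ (fun t : ℝ => (⟨v.proj, v.snd + t • q⟩ : TangentBundle I M)) =
      fun t : ℝ => (⟨v.proj, g.inner v.proj v.snd + t • g.inner v.proj q⟩ :
        CotangentBundle I M) := by
    funext t
    change (⟨v.proj, g.inner v.proj (v.snd + t • q)⟩ : CotangentBundle I M) = _
    rw [map_add, map_smul]
  rw [h2] at h
  have h3 := mfderiv_flat_congr g hv
  refine Eq.trans ?_ (congrArg (fun L : ℝ →L[ℝ] (E × (E →L[ℝ] ℝ)) => L 1) h).symm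
  exact (congrArg (fun L : E × E →L[ℝ] E × (E →L[ℝ] ℝ) => L (vlift I v q)) h3).symm

lemma mfderiv_flat_tangentSection (v : TangentBundle I M) (u : TangentSpace I v.proj)
    (w : TangentSpace I v.proj) :
    Prod.snd (α := E) (β := E →L[ℝ] ℝ)
      (mfderiv (I.prod 𝓘(ℝ, E)) (I.prod 𝓘(ℝ, E →L[ℝ] ℝ)) (flat g) v
        (tangentSection v (extend E v.snd) u)) w
      = d% (metricPairing g (extend E v.snd) (extend E w)) v.proj u := by
  set X := extend E v.snd
  set W := extend E w
  have hX : MDiffAt (T% X) v.proj := mdifferentiableAt_extend I E v.snd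
  have hv : (⟨v.proj, X v.proj⟩ : TangentBundle I M) = v := by
    rw [show X v.proj = v.snd from extend_apply_self E v.snd]
  have hc := mfderiv_comp_of_eq (mdifferentiable_flat g v) hX hv
  have hd : MDifferentiableAt I (I.prod 𝓘(ℝ, E →L[ℝ] ℝ))
      (fun y => flat g (⟨y, X y⟩ : TangentBundle I M)) v.proj :=
    MDifferentiableAt.comp_of_eq v.proj (mdifferentiable_flat g v) hX hv
  set e := trivializationAt (E →L[ℝ] ℝ) (CotangentSpace I : M → Type _) v.proj
  have h1 := congrArg (fun z : E × (E →L[ℝ] ℝ) => z.2 w) (mfderiv_totalSpace hd u)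
  have h2 : MDifferentiableAt I 𝓘(ℝ, E →L[ℝ] ℝ)
      (fun y => (e (flat g (⟨y, X y⟩ : TangentBundle I M))).2) v.proj :=
    ((mdifferentiableAt_totalSpace I _).1 hd).2
  obtain ⟨L, hL⟩ : ∃ L : (E →L[ℝ] ℝ) →L[ℝ] ℝ, ∀ p, L p = p w :=
    ⟨ContinuousLinearMap.apply ℝ ℝ w, fun _ => rfl⟩
  have h3 := ((L.hasMFDerivAt).comp v.proj
    h2.hasMFDerivAt).mfderiv
  have h4 : metricPairing g X W =ᶠ[𝓝 v.proj] L ∘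
      fun y => (e (flat g (⟨y, X y⟩ : TangentBundle I M))).2 := by
    filter_upwards [(chartAt H v.proj).open_source.mem_nhds (mem_chart_source H v.proj)] with y hy
    refine Eq.trans ?_ ((hL _).trans (trivializationAt_cotangent_snd v.proj
      (flat g (⟨y, X y⟩ : TangentBundle I M)) w)).symm
    change g.inner y (X y) (W y) = g.inner y (X y) _
    refine congrArg (g.inner y (X y)) ?_
    refine Eq.trans ?_ (Trivialization.symmL_apply (R := ℝ) _ (by simpa using hy) _).symm
    change (trivializationAt E (TangentSpace I) v.proj).symm y _ = _
    rw [trivializationAt_snd_self]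
  have h5 := h4.mfderiv_eq (I := I) (I' := 𝓘(ℝ, ℝ))
  have h6 := congrArg (fun T : E →L[ℝ] ℝ => T u) (h5.trans h3)
  have h7 := congrArg (fun T : E × E →L[ℝ] E × (E →L[ℝ] ℝ) => (T (tangentSection v X u)).2 w)
    (mfderiv_flat_congr g hv)
  have h8 := congrArg (fun T : E →L[ℝ] (E × (E →L[ℝ] ℝ)) => (T u).2 w) hc
  exact h7.symm.trans (h8.symm.trans (h1.trans ((hL _).symm.trans h6.symm)))

/-- The horizontal lift to `T*M` in the chart at the base point. -/
lemma mfderiv_flat_hlift_snd (v : TangentBundle I M) (u w : TangentSpace I v.proj) :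
    Prod.snd (α := E) (β := E →L[ℝ] ℝ)
      (mfderiv (I.prod 𝓘(ℝ, E)) (I.prod 𝓘(ℝ, E →L[ℝ] ℝ)) (flat g) v (hlift g v u)) w
      = g.inner v.proj v.snd (leviCivita g (extend E w) v.proj u) := by
  have h1 : hlift g v u = tangentSection v (extend E v.snd) u
      - vlift I v (leviCivita g (extend E v.snd) v.proj u) := rfl
  have h2 := mfderiv_flat_tangentSection g v u w
  rw [leviCivita_metric g (mdifferentiableAt_extend I E v.snd) (mdifferentiableAt_extend I E w)]
    at h2
  have h3 := vlift_cotangent_snd (flat g v)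
    (g.inner v.proj (leviCivita g (extend E v.snd) v.proj u)) w
  rw [← mfderiv_flat_vlift] at h3
  have h4 := ContinuousLinearMap.map_sub
    (mfderiv (I.prod 𝓘(ℝ, E)) (I.prod 𝓘(ℝ, E →L[ℝ] ℝ)) (flat g) v)
    (tangentSection v (extend E v.snd) u) (vlift I v (leviCivita g (extend E v.snd) v.proj u))
  rw [h1]
  refine (congrArg (fun z : E × (E →L[ℝ] ℝ) => z.2 w) h4).trans ?_
  refine (congrArg₂ (· - ·) h2 h3).trans ?_
  rw [extend_apply_self, extend_apply_self]
  exact add_sub_cancel_left _ _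

lemma connectorStar_flat (v : TangentBundle I M)
    (ξ : TangentSpace (I.prod 𝓘(ℝ, E →L[ℝ] ℝ)) (flat g v)) (w : TangentSpace I v.proj) :
    connectorStar g (flat g v) ξ w = Prod.snd (α := E) (β := E →L[ℝ] ℝ) ξ w
      - g.inner v.proj v.snd (leviCivita g (extend E w) v.proj (tangentProj I (flat g v) ξ)) := by
  set ζ := mfderiv (I.prod 𝓘(ℝ, E)) (I.prod 𝓘(ℝ, E →L[ℝ] ℝ)) (flat g) v
      (hlift g v (tangentProj I (flat g v) ξ)) with hζ
  have hver : ξ - ζ ∈ ver I (flat g v) := by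
    rw [ver, LinearMap.mem_ker]
    refine (map_sub (tangentProj I (flat g v)) ξ ζ).trans (sub_eq_zero.2 ?_)
    rw [hζ, tangentProj_mfderiv_flat]
    exact (tangentProj_hlift g v _).symm
  have hhor : ζ ∈ horStar g (flat g v) := ⟨v, _, ⟨_, rfl⟩, rfl⟩
  have hproj : (ver I (flat g v)).projectionOnto (horStar g (flat g v))
      (isCompl_ver_horStar g (flat g v)) ξ = ⟨ξ - ζ, hver⟩ := by
    conv_lhs => rw [← sub_add_cancel ξ ζ, map_add]
    rw [Submodule.projectionOnto_apply_of_mem_left _ hver,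
      (Submodule.projectionOnto_apply_eq_zero_iff _).2 hhor, add_zero]
  have h1 : vlift I (flat g v) (connectorStar g (flat g v) ξ) = ξ - ζ := by
    rw [← coe_vl, connectorStar, LinearMap.comp_apply, hproj]
    exact congrArg Subtype.val ((vl I (flat g v)).apply_symm_apply _)
  have h2 := vlift_cotangent_snd (flat g v) (connectorStar g (flat g v) ξ) w
  rw [h1] at h2
  refine h2.symm.trans ?_
  exact congrArg (fun r : ℝ => Prod.snd (α := E) (β := E →L[ℝ] ℝ) ξ w - r)
    (mfderiv_flat_hlift_snd g v (tangentProj I (flat g v) ξ) w)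

end

end RiemannianCotangent

theorem mainTheorem5 {E : Type*} [NormedAddCommGroup E] [NormedSpace ℝ E] [FiniteDimensional ℝ E]
    {H : Type*} [TopologicalSpace H] (I : ModelWithCorners ℝ E H)
    {M : Type*} [TopologicalSpace M] [ChartedSpace H M] [IsManifold I ∞ M]
    (g : SmoothRiemannianMetric I M) (α : CotangentBundle I M)
    (ξ η : TangentSpace (I.prod 𝓘(ℝ, E →L[ℝ] ℝ)) α) :
    canonicalSymplecticForm I M α ![ξ, η] =
      wedgePairing (tangentProj I α).toLinearMap (connectorStar g α) ξ η := by
  obtain ⟨v, rfl⟩ := flat_surjective g α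
  rw [canonicalSymplecticForm_apply, wedgePairing]
  have hη := connectorStar_flat g v η (tangentProj I (flat g v) ξ)
  have hξ := connectorStar_flat g v ξ (tangentProj I (flat g v) η)
  have hsymm := congrArg (g.inner v.proj v.snd) (leviCivita_extend_comm g v.proj
    (tangentProj I (flat g v) η) (tangentProj I (flat g v) ξ))
  replace hη := hη.trans (congrArg (fun r : ℝ => _ - r) hsymm)
  refine Eq.trans ?_ (congrArg₂ (· - ·) hη hξ).symm
  simp only [tangentProj_apply]
  exact (sub_sub_sub_cancel_right _ _ _).symm
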